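/- Let $S$, $A$, $C$ be finite sets of states, actions and tasks, $P(s'|s,a)$ a transition kernel, $\rho_0$ an initial distribution on $S$, $\gamma\in[0,1)$ and $p$ a distribution on $C$. A policy is a stationary task-conditioned policy $\pi(a|s,c)$. Put $$d_\pi(s,c)=p(c)\sum_{t\ge 0}\gamma^t\Pr(s_t=s\mid\pi,c),\qquad \rho_\pi(s,a,c)=d_\pi(s,c)\,\pi(a|s,c),$$ $\mathbb E_{c,\pi}[g]=\sum_{s,a,c}\rho_\pi(s,a,c)g(s,a,c)$ and $H(\pi)=\mathbb E_{c,\pi}[-\log\pi(a|s,c)]$, with $0\log 0=0$. For a cost $l:S\times A\times C\to\mathbb R$ write $\mathrm{RL}(l)=\operatorname{argmin}_\pi\,\bigl(-H(\pi)+\mathbb E_{c,\pi}[l]\bigr)$. Let the expert $\pi_E$ follow RL principles, i.e. $\pi_E\in\mathrm{RL}(l_E)$ for some $l_E:S\times A\times C\to\mathbb R$, and put $\rho_E=\rho_{\pi_E}$. For $f:S\times A\times C\to\mathbb R$ and a policy $\pi$ let $$D_{f,\pi}(s,a,c)=\frac{\exp f(s,a,c)}{\exp f(s,a,c)+\pi(a|s,c)},$$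 $$L_D(f,\pi)=\mathbb E_{c,\pi_E}[\log D_{f,\pi}]+\mathbb E_{c,\pi}[\log(1-D_{f,\pi})],\qquad L_G(f,\pi)=\mathbb E_{c,\pi}[\log(1-D_{f,\pi})]-\mathbb E_{c,\pi}[\log D_{f,\pi}].$$ A pair $(f,\pi)$ is an adversarial solution if $f$ maximizes $L_D(\cdot,\pi)$ and $\pi$ minimizes $L_G(f,\cdot)$. For $\psi:\mathbb R^{S\times A\times C}\to[-\infty,\infty]$ let $\psi^*(x)=\sup_l\,(\langle x,l\rangle-\psi(l))$ and consider $$(\ast)\qquad \operatorname{argmin}_\pi\; -H(\pi)+\psi^*(\rho_\pi-\rho_E).$$ Then: (1) For $\psi=0$ (inverse RL without a penalty on the costs), a policy $\pi$ belongs to an adversarial solution $(f,\pi)$ if and only if it solves $(\ast)$. The same holds for every $\psi$ that attains its minimum at $l_E$ with $\psi(l_E)$ finite. (2) For each $\pi$ the function $\psi_\pi(l)=\mathbb E_{c,\pi}[l]+\mathbb E_{c,\pi_E}[\log(e^{-l}+\pi)]+\mathbb E_{c,\pi}[\log(e^{-l}+\pi)]$ is convex and $-H(\pi)+\psi_\pi^*(\rho_\pi-\rho_E)=\sup_f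 L_D(f,\pi)$. A policy $\pi$ belongs to an adversarial solution if and only if it minimizes $-H(\pi)+\psi_\pi^*(\rho_\pi-\rho_E)$ over all policies. (3) For all $f$ and $\pi$, $L_G(f,\pi)=-H(\pi)+\mathbb E_{c,\pi}[-f]$. If $(f,\pi)$ is an adversarial solution, then $\pi\in\mathrm{RL}(-f)$, and $l=-f$ maximizes the inverse RL objective $\min_{\pi'}\bigl(-H(\pi')+\mathbb E_{c,\pi'}[l]\bigr)-\mathbb E_{c,\pi_E}[l]$. (4) A policy $\pi$ belongs to an adversarial solution if and only if $\rho_\pi=\rho_E$. Every adversarial solution $(f,\pi)$ satisfies $\pi(a|s,c)=\pi_E(a|s,c)$ and $f(s,a,c)=\log\pi_E(a|s,c)$ for all $a$ and all $(s,c)$ with $d_{\pi_E}(s,c)>0$. If $\rho_0$ and $p$ are everywhere positive, there is exactly one adversarial solution. -/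

import Mathlib

noncomputable section

/-- A finite Markov decision process with transition probabilities `P s a s'`, discount factor `γ`
and initial distribution `ρ₀`, together with a distribution `p` of the task variable. -/
structure TaskMDP (S A C : Type*) [Fintype S] [Fintype C] where
  P : S → A → S → ℝ
  P_nonneg : ∀ s a s', 0 ≤ P s a s'
  P_sum : ∀ s a, ∑ s', P s a s' = 1
  γ : ℝ
  γ_nonneg : 0 ≤ γ
  γ_lt_one : γ < 1
  ρ₀ : S → ℝ
  ρ₀_nonneg : ∀ s, 0 ≤ ρ₀ s
  ρ₀_sum : ∑ s, ρ₀ s = 1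
  p : C → ℝ
  p_nonneg : ∀ c, 0 ≤ p c
  p_sum : ∑ c, p c = 1

/-- A stationary task-conditioned policy; `prob s c a` is `π(a | s, c)`. -/
@[ext]
structure TaskPolicy (S A C : Type*) [Fintype A] where
  prob : S → C → A → ℝ
  nonneg : ∀ s c a, 0 ≤ prob s c a
  sum_one : ∀ s c, ∑ a, prob s c a = 1

namespace TaskMDP

variable {S A C : Type*} [Fintype S] [Fintype A] [Fintype C]

/-- The law of the state `s_t` when the policy `π` is run on task `c`. -/
def stateLaw (M : TaskMDP S A C) (π : TaskPolicy S A C) (c : C) : ℕ → S → ℝ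
  | 0 => M.ρ₀
  | t + 1 => fun s => ∑ s', ∑ a, M.stateLaw π c t s' * π.prob s' c a * M.P s' a s

/-- Discounted state-task visitation `p(c) ∑ₜ γᵗ Pr(s_t = s | π, c)`. -/
def visit (M : TaskMDP S A C) (π : TaskPolicy S A C) (s : S) (c : C) : ℝ :=
  M.p c * ∑' t : ℕ, M.γ ^ t * M.stateLaw π c t s

/-- The occupancy measure `ρ_π(s, a, c) = p(c) ∑ₜ γᵗ Pr(s_t = s, a_t = a | π, c)`. -/
def occ (M : TaskMDP S A C) (π : TaskPolicy S A C) (s : S) (a : A) (c : C) : ℝ :=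
  M.visit π s c * π.prob s c a

/-- The pairing `∑ ρ(s, a, c) g(s, a, c)`. -/
def pairing (ρ g : S → A → C → ℝ) : ℝ := ∑ s, ∑ a, ∑ c, ρ s a c * g s a c

/-- The expectation `E_{c ∼ p(c), π}[g(s, a, c)]` (discounted along trajectories). -/
def expect (M : TaskMDP S A C) (π : TaskPolicy S A C) (g : S → A → C → ℝ) : ℝ :=
  pairing (M.occ π) g

/-- The entropy `H(π) = E_{c, π}[-log π(a | s, c)]`. -/
def entropy (M : TaskMDP S A C) (π : TaskPolicy S A C) : ℝ :=
  M.expect π fun s a c => -Real.log (π.prob s c a)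

/-- The objective `-H(π) + E_π[l]` of entropy-regularized RL with cost `l`. -/
def rlObjective (M : TaskMDP S A C) (l : S → A → C → ℝ) (π : TaskPolicy S A C) : ℝ :=
  -M.entropy π + M.expect π l

/-- `π` solves the entropy-regularized RL problem with cost `l`. -/
def IsRLSolution (M : TaskMDP S A C) (l : S → A → C → ℝ) (π : TaskPolicy S A C) : Prop :=
  ∀ π', M.rlObjective l π ≤ M.rlObjective l π'

/-- The objective `(min_π -H(π) + E_π[l]) - E_{π_E}[l]` of inverse RL. -/
def irlObjective (M : TaskMDP S A C) (πE : TaskPolicy S A C) (l : S → A → C → ℝ) : ℝ :=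
  (⨅ π, M.rlObjective l π) - M.expect πE l

/-- `l` solves the inverse RL problem for the expert `πE`. -/
def IsIRLSolution (M : TaskMDP S A C) (πE : TaskPolicy S A C) (l : S → A → C → ℝ) : Prop :=
  ∀ l', M.irlObjective πE l' ≤ M.irlObjective πE l

/-- The convex conjugate `ψ*(x) = sup_l ⟨x, l⟩ - ψ(l)`. -/
def conjugate (ψ : (S → A → C → ℝ) → EReal) (x : S → A → C → ℝ) : EReal :=
  ⨆ l : S → A → C → ℝ, ((pairing x l : ℝ) : EReal) - ψ l

/-- The objective `-H(π) + ψ*(ρ_π - ρ_E)`. -/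
def regObjective (M : TaskMDP S A C) (ψ : (S → A → C → ℝ) → EReal) (πE π : TaskPolicy S A C) :
    EReal :=
  ((-M.entropy π : ℝ) : EReal) + conjugate ψ (M.occ π - M.occ πE)

/-- `π ∈ argmin_π -H(π) + ψ*(ρ_π - ρ_E)`. -/
def IsRegSolution (M : TaskMDP S A C) (ψ : (S → A → C → ℝ) → EReal) (πE π : TaskPolicy S A C) :
    Prop :=
  ∀ π', M.regObjective ψ πE π ≤ M.regObjective ψ πE π'

/-- The odds-ratio discriminator `exp f / (exp f + π(a | s, c))`. -/
def disc (f : S → A → C → ℝ) (π : TaskPolicy S A C) (s : S) (a : A) (c : C) : ℝ :=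
  Real.exp (f s a c) / (Real.exp (f s a c) + π.prob s c a)

/-- The discriminator objective `E_{c, π_E}[log D] + E_{c, π}[log (1 - D)]`. -/
def discObjective (M : TaskMDP S A C) (πE : TaskPolicy S A C) (f : S → A → C → ℝ)
    (π : TaskPolicy S A C) : ℝ :=
  M.expect πE (fun s a c => Real.log (disc f π s a c)) +
    M.expect π (fun s a c => Real.log (1 - disc f π s a c))

/-- The generator objective `E_{c, π}[log (1 - D)] - E_{c, π}[log D]`. -/
def genObjective (M : TaskMDP S A C) (f : S → A → C → ℝ) (π : TaskPolicy S A C) : ℝ :=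
  M.expect π (fun s a c => Real.log (1 - disc f π s a c)) -
    M.expect π (fun s a c => Real.log (disc f π s a c))

/-- `(f, π)` solves the two adversarial problems simultaneously: `f` maximizes the discriminator
objective given `π`, and `π` minimizes the generator objective given `f`. -/
def IsAdversarialSolution (M : TaskMDP S A C) (πE : TaskPolicy S A C) (f : S → A → C → ℝ)
    (π : TaskPolicy S A C) : Prop :=
  (∀ f', M.discObjective πE f' π ≤ M.discObjective πE f π) ∧
    (∀ π', M.genObjective f π ≤ M.genObjective f π')

/-- The regularizer of the cost `l = -f` induced by the odds-ratio discriminator,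
`E_π[l] + E_{π_E}[log (exp (-l) + π)] + E_π[log (exp (-l) + π)]`. -/
def discRegularizer (M : TaskMDP S A C) (πE π : TaskPolicy S A C) (l : S → A → C → ℝ) : ℝ :=
  M.expect π l + M.expect πE (fun s a c => Real.log (Real.exp (-l s a c) + π.prob s c a)) +
    M.expect π (fun s a c => Real.log (Real.exp (-l s a c) + π.prob s c a))

end TaskMDP

end

/-! Every condition on `π` is shown to be equivalent to `M.occ π = M.occ πE`.

Two facts on entropy-regularized RL carry the argument. Occupancies form a convex set
(`exists_mixture`), and the objective is strictly convex on it, with Jensen gap a weighted sum of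
divergences (`rlObjective_mixture`); so solutions share one occupancy (`IsRLSolution.occ_eq`). The
entropy has infinite slope at the boundary, so solutions take every action wherever they go
(`IsRLSolution.prob_pos`).

For an adversarial solution, the first-order condition gives `f = log ρ_E - log d_π` on visited
states, and `π` solves RL with cost `-f`. There the objective of `π` is a Kullback-Leibler
divergence of `ρ_π` from `ρ_E`, hence `≥ 0`, while that of the expert is minus a divergence of
visitations, hence `≤ 0`; optimality of `π` forces equality (`IsAdversarialSolution.occ_eq`).
Conversely `f = log π` works.

For a regularizer minimal at `lE`, the regularized objective dominates the RL objective of `lE` up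
to a constant, with equality at the expert's occupancy. For the discriminator's regularizer it is
the supremum of the discriminator objective, which is at least the coin-flip value `-2 log 2 / (1 -
γ)`, with equality exactly at that occupancy. -/

/-- The uniform policy. -/
noncomputable def TaskPolicy.uniform (S A C : Type*) [Fintype A] [Nonempty A] :
    TaskPolicy S A C where
  prob _ _ _ := (Fintype.card A : ℝ)⁻¹
  nonneg _ _ _ := by positivity
  sum_one _ _ := by simp

theorem TaskPolicy.prob_le_one {S A C : Type*} [Fintype A] (π : TaskPolicy S A C) (s : S) (c : C)
    (a : A) : π.prob s c a ≤ 1 := by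
  rw [← π.sum_one s c]
  exact Finset.single_le_sum (fun b _ => π.nonneg s c b) (Finset.mem_univ a)

/-! ### Real inequalities and separable maximization -/

/-- The tangent inequality behind the nonnegativity of the Kullback-Leibler divergence. -/
theorem sub_le_mul_log_sub_log {x y : ℝ} (hx : 0 ≤ x) (hy : 0 ≤ y) (h : 0 < x → 0 < y) :
    x - y ≤ x * (Real.log x - Real.log y) := by
  rcases hx.eq_or_lt with rfl | hx
  · simpa using hy
  · have hy := h hx
    have h1 := Real.log_le_sub_one_of_pos (div_pos hy hx)
    rw [Real.log_div hy.ne' hx.ne'] at h1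
    have h2 := mul_le_mul_of_nonneg_left h1 hx.le
    have h3 : x * (y / x - 1) = y - x := by field_simp
    linarith

theorem eq_of_mul_log_sub_log_le {x y : ℝ} (hx : 0 ≤ x) (hy : 0 ≤ y) (h : 0 < x → 0 < y)
    (hxy : x * (Real.log x - Real.log y) ≤ x - y) : x = y := by
  rcases hx.eq_or_lt with rfl | hx
  · simp at hxy
    linarith
  · have hy := h hx
    by_contra hne
    have h1 := Real.log_lt_sub_one_of_pos (div_pos hy hx)
      (fun h => hne ((div_eq_one_iff_eq hx.ne').1 h).symm)
    rw [Real.log_div hy.ne' hx.ne'] at h1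
    have h2 := mul_lt_mul_of_pos_left h1 hx
    have h3 : x * (y / x - 1) = y - x := by field_simp
    linarith

/-- The derivative is the logistic function `exp x / (exp x + k)`, which is monotone for `k ≥ 0`. -/
theorem convexOn_log_exp_add {k : ℝ} (hk : 0 ≤ k) :
    ConvexOn ℝ Set.univ fun x : ℝ => Real.log (Real.exp x + k) := by
  have hd : ∀ x, HasDerivAt (fun x : ℝ => Real.log (Real.exp x + k))
      (Real.exp x / (Real.exp x + k)) x := fun x =>
    ((Real.hasDerivAt_exp x).add_const k).log (by positivity)
  refine Monotone.convexOn_univ_of_deriv (fun x => (hd x).differentiableAt) ?_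
  intro x y hxy
  rw [(hd x).deriv, (hd y).deriv, div_le_div_iff₀ (by positivity) (by positivity)]
  have := mul_le_mul_of_nonneg_right (Real.exp_le_exp.2 hxy) hk
  nlinarith

/-- A maximizer of a separable function maximizes every summand. -/
theorem le_of_forall_sum_le {ι : Type*} [Fintype ι] (T : ι → ℝ → ℝ) (f : ι → ℝ)
    (h : ∀ f' : ι → ℝ, ∑ i, T i (f' i) ≤ ∑ i, T i (f i)) (i : ι) (x : ℝ) : T i x ≤ T i (f i) := by
  classical
  by_contra! hlt
  refine (h (Function.update f i x)).not_gt (Finset.sum_lt_sum (fun j _ => ?_)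
    ⟨i, Finset.mem_univ i, by simpa using hlt⟩)
  by_cases hj : j = i
  · subst hj
    simpa using hlt.le
  · simp [hj]

theorem log_le_neg_two_log_two {D : ℝ} (h0 : 0 < D) (h1 : D < 1) :
    Real.log D + Real.log (1 - D) ≤ -(2 * Real.log 2) := by
  rw [← Real.log_mul h0.ne' (by linarith), ← Real.log_rpow two_pos, ← Real.log_inv]
  refine Real.log_le_log (mul_pos h0 (by linarith)) ?_
  norm_num
  nlinarith [sq_nonneg (D - 1 / 2)]

namespace TaskMDP

theorem one_sub_disc {S A C : Type*} [Fintype A]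
    (f : S → A → C → ℝ) (π : TaskPolicy S A C) (s : S) (a : A) (c : C) :
    1 - disc f π s a c = π.prob s c a / (Real.exp (f s a c) + π.prob s c a) := by
  have h : Real.exp (f s a c) + π.prob s c a ≠ 0 :=
    (add_pos_of_pos_of_nonneg (Real.exp_pos _) (π.nonneg _ _ _)).ne'
  rw [disc, eq_div_iff h, sub_mul, div_mul_cancel₀ _ h]
  ring

theorem log_disc {S A C : Type*} [Fintype A]
    (f : S → A → C → ℝ) (π : TaskPolicy S A C) (s : S) (a : A) (c : C) :
    Real.log (disc f π s a c) =
      f s a c - Real.log (Real.exp (f s a c) + π.prob s c a) := by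
  have h : Real.exp (f s a c) + π.prob s c a ≠ 0 :=
    (add_pos_of_pos_of_nonneg (Real.exp_pos _) (π.nonneg _ _ _)).ne'
  rw [disc, Real.log_div (Real.exp_pos _).ne' h, Real.log_exp]

/-- Positivity matters: at probability zero the left side is `log 0 = 0` and the right side is `-f`.
Expectations under `π` ignore such actions. -/
theorem log_one_sub_disc {S A C : Type*} [Fintype A]
    (f : S → A → C → ℝ) {π : TaskPolicy S A C} {s : S} {a : A} {c : C}
    (hπ : 0 < π.prob s c a) : Real.log (1 - disc f π s a c) =
      Real.log (π.prob s c a) - Real.log (Real.exp (f s a c) + π.prob s c a) := by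
  rw [one_sub_disc, Real.log_div hπ.ne' (by positivity)]

variable {S A C : Type*} [Fintype S] [Fintype A] [Fintype C]

/-! ### Visitation and occupancy -/

theorem stateLaw_nonneg (M : TaskMDP S A C) (π : TaskPolicy S A C) (c : C) (t : ℕ) (s : S) :
    0 ≤ M.stateLaw π c t s := by
  induction t generalizing s with
  | zero => exact M.ρ₀_nonneg s
  | succ t ih =>
    exact Finset.sum_nonneg fun s' _ => Finset.sum_nonneg fun a _ =>
      mul_nonneg (mul_nonneg (ih s') (π.nonneg _ _ _)) (M.P_nonneg _ _ _)

/-- One step of the chain preserves mass. The vector `d` is arbitrary so as to cover state laws,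
visitations and absolute differences of these. -/
theorem sum_sum_sum_mul_P (M : TaskMDP S A C) (π : TaskPolicy S A C) (c : C) (d : S → ℝ) :
    ∑ s, ∑ s', ∑ a, d s' * π.prob s' c a * M.P s' a s = ∑ s, d s := by
  rw [Finset.sum_comm]
  refine Finset.sum_congr rfl fun s' _ => ?_
  rw [Finset.sum_comm]
  simp_rw [← Finset.mul_sum, M.P_sum, mul_one, ← Finset.mul_sum, π.sum_one, mul_one]

theorem stateLaw_sum (M : TaskMDP S A C) (π : TaskPolicy S A C) (c : C) (t : ℕ) :
    ∑ s, M.stateLaw π c t s = 1 := by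
  induction t with
  | zero => exact M.ρ₀_sum
  | succ t ih => exact (M.sum_sum_sum_mul_P π c (M.stateLaw π c t)).trans ih

theorem stateLaw_le_one (M : TaskMDP S A C) (π : TaskPolicy S A C) (c : C) (t : ℕ) (s : S) :
    M.stateLaw π c t s ≤ 1 := by
  rw [← M.stateLaw_sum π c t]
  exact Finset.single_le_sum (fun b _ => M.stateLaw_nonneg π c t b) (Finset.mem_univ s)

theorem summable_stateLaw (M : TaskMDP S A C) (π : TaskPolicy S A C) (c : C) (s : S) :
    Summable fun t : ℕ => M.γ ^ t * M.stateLaw π c t s :=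
  Summable.of_nonneg_of_le
    (fun t => mul_nonneg (pow_nonneg M.γ_nonneg t) (M.stateLaw_nonneg π c t s))
    (fun t => mul_le_of_le_one_right (pow_nonneg M.γ_nonneg t) (M.stateLaw_le_one π c t s))
    (summable_geometric_of_lt_one M.γ_nonneg M.γ_lt_one)

theorem visit_nonneg (M : TaskMDP S A C) (π : TaskPolicy S A C) (s : S) (c : C) :
    0 ≤ M.visit π s c :=
  mul_nonneg (M.p_nonneg c)
    (tsum_nonneg fun t => mul_nonneg (pow_nonneg M.γ_nonneg t) (M.stateLaw_nonneg π c t s))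

theorem occ_nonneg (M : TaskMDP S A C) (π : TaskPolicy S A C) (s : S) (a : A) (c : C) :
    0 ≤ M.occ π s a c :=
  mul_nonneg (M.visit_nonneg π s c) (π.nonneg s c a)

theorem sum_occ (M : TaskMDP S A C) (π : TaskPolicy S A C) (s : S) (c : C) :
    ∑ a, M.occ π s a c = M.visit π s c := by
  simp_rw [occ, ← Finset.mul_sum, π.sum_one, mul_one]

/-- The Bellman flow equation. -/
theorem visit_eq (M : TaskMDP S A C) (π : TaskPolicy S A C) (s : S) (c : C) :
    M.visit π s c =
      M.p c * M.ρ₀ s + M.γ * ∑ s', ∑ a, M.visit π s' c * π.prob s' c a * M.P s' a s := by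
  have h : ∀ s' a, HasSum
      (fun t : ℕ => M.γ ^ t * M.stateLaw π c t s' * π.prob s' c a * M.P s' a s)
      ((∑' t : ℕ, M.γ ^ t * M.stateLaw π c t s') * π.prob s' c a * M.P s' a s) := fun s' a =>
    ((M.summable_stateLaw π c s').hasSum.mul_right _).mul_right _
  have h2 := (hasSum_sum (s := Finset.univ) fun s' _ =>
    hasSum_sum (s := Finset.univ) fun a _ => h s' a).mul_left M.γ
  have h3 : ∑' t : ℕ, M.γ ^ (t + 1) * M.stateLaw π c (t + 1) s =
      M.γ * ∑ s', ∑ a,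
        (∑' t : ℕ, M.γ ^ t * M.stateLaw π c t s') * π.prob s' c a * M.P s' a s := by
    rw [← h2.tsum_eq]
    refine tsum_congr fun t => ?_
    simp only [stateLaw, Finset.mul_sum]
    exact Finset.sum_congr rfl fun s' _ => Finset.sum_congr rfl fun a _ => by ring
  rw [visit, (M.summable_stateLaw π c s).tsum_eq_zero_add, h3]
  simp only [visit, stateLaw, pow_zero, one_mul, mul_add, Finset.mul_sum]
  congr 1
  exact Finset.sum_congr rfl fun s' _ => Finset.sum_congr rfl fun a _ => by ring

/-- The flow map is `γ` times a positive mass-preserving operator, so the `ℓ¹` distance between two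
fixed points is at most `γ < 1` times itself. -/
theorem visit_unique (M : TaskMDP S A C) (π : TaskPolicy S A C) (d : S → C → ℝ)
    (hd : ∀ s c, d s c =
      M.p c * M.ρ₀ s + M.γ * ∑ s', ∑ a, d s' c * π.prob s' c a * M.P s' a s) (s : S) (c : C) :
    d s c = M.visit π s c := by
  have h1 : ∀ s, |d s c - M.visit π s c| ≤
      M.γ * ∑ s', ∑ a, |d s' c - M.visit π s' c| * π.prob s' c a * M.P s' a s := by
    intro s
    have : d s c - M.visit π s c =
        M.γ * ∑ s', ∑ a, (d s' c - M.visit π s' c) * π.prob s' c a * M.P s' a s := by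
      conv_lhs => rw [hd s c, M.visit_eq π s c]
      simp_rw [sub_mul, Finset.sum_sub_distrib]
      ring
    rw [this, abs_mul, abs_of_nonneg M.γ_nonneg]
    refine mul_le_mul_of_nonneg_left ?_ M.γ_nonneg
    refine (Finset.abs_sum_le_sum_abs _ _).trans (Finset.sum_le_sum fun s' _ =>
      (Finset.abs_sum_le_sum_abs _ _).trans (Finset.sum_le_sum fun a _ => ?_))
    rw [abs_mul, abs_mul, abs_of_nonneg (π.nonneg _ _ _), abs_of_nonneg (M.P_nonneg _ _ _)]
  have h2 := Finset.sum_le_sum fun s (_ : s ∈ Finset.univ) => h1 s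
  rw [← Finset.mul_sum, M.sum_sum_sum_mul_P π c fun s' => |d s' c - M.visit π s' c|] at h2
  have h3 : |d s c - M.visit π s c| ≤ ∑ s, |d s c - M.visit π s c| :=
    Finset.single_le_sum (f := fun s => |d s c - M.visit π s c|) (fun _ _ => abs_nonneg _)
      (Finset.mem_univ s)
  have h4 : 0 ≤ ∑ s, |d s c - M.visit π s c| := Finset.sum_nonneg fun _ _ => abs_nonneg _
  have h5 : |d s c - M.visit π s c| = 0 := by
    have := M.γ_lt_one
    refine le_antisymm ?_ (abs_nonneg _)
    nlinarith
  exact sub_eq_zero.1 (abs_eq_zero.1 h5)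

theorem sum_visit (M : TaskMDP S A C) (π : TaskPolicy S A C) (c : C) :
    ∑ s, M.visit π s c = M.p c * (1 - M.γ)⁻¹ := by
  have h : ∑ s, M.visit π s c = M.p c + M.γ * ∑ s, M.visit π s c := by
    refine (Finset.sum_congr rfl fun s _ => M.visit_eq π s c).trans ?_
    rw [Finset.sum_add_distrib, ← Finset.mul_sum, M.ρ₀_sum, ← Finset.mul_sum,
      M.sum_sum_sum_mul_P π c fun s => M.visit π s c, mul_one]
  have := M.γ_lt_one
  rw [eq_mul_inv_iff_mul_eq₀ (by linarith)]
  linarith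

theorem sum_sum_visit (M : TaskMDP S A C) (π : TaskPolicy S A C) :
    ∑ s, ∑ c, M.visit π s c = (1 - M.γ)⁻¹ := by
  rw [Finset.sum_comm]
  simp_rw [M.sum_visit π, ← Finset.sum_mul, M.p_sum, one_mul]

theorem sum_sum_sum_occ (M : TaskMDP S A C) (π : TaskPolicy S A C) :
    ∑ s, ∑ a, ∑ c, M.occ π s a c = (1 - M.γ)⁻¹ := by
  rw [← M.sum_sum_visit π]
  refine Finset.sum_congr rfl fun s _ => ?_
  rw [Finset.sum_comm]
  simp_rw [sum_occ]

theorem visit_le (M : TaskMDP S A C) (π : TaskPolicy S A C) (s : S) (c : C) :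
    M.visit π s c ≤ (1 - M.γ)⁻¹ := by
  rw [← M.sum_sum_visit π]
  exact (Finset.single_le_sum (f := fun c => M.visit π s c) (fun _ _ => M.visit_nonneg _ _ _)
    (Finset.mem_univ c)).trans (Finset.single_le_sum (f := fun s => ∑ c, M.visit π s c)
      (fun _ _ => Finset.sum_nonneg fun _ _ => M.visit_nonneg _ _ _) (Finset.mem_univ s))

theorem occ_le (M : TaskMDP S A C) (π : TaskPolicy S A C) (s : S) (a : A) (c : C) :
    M.occ π s a c ≤ (1 - M.γ)⁻¹ :=
  (mul_le_of_le_one_right (M.visit_nonneg π s c) (π.prob_le_one s c a)).trans (M.visit_le π s c)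

theorem flow_nonneg (M : TaskMDP S A C) (π : TaskPolicy S A C) (s : S) (c : C) :
    0 ≤ M.γ * ∑ s', ∑ a, M.visit π s' c * π.prob s' c a * M.P s' a s :=
  mul_nonneg M.γ_nonneg <| Finset.sum_nonneg fun s' _ => Finset.sum_nonneg fun a _ =>
    mul_nonneg (M.occ_nonneg π s' a c) (M.P_nonneg _ _ _)

theorem mul_le_visit (M : TaskMDP S A C) (π : TaskPolicy S A C) (s : S) (c : C) :
    M.p c * M.ρ₀ s ≤ M.visit π s c := by
  rw [M.visit_eq π s c]
  exact le_add_of_nonneg_right (M.flow_nonneg π s c)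

/-- A policy that takes every action wherever it goes visits all that any policy visits. -/
theorem visit_pos_of_visit_pos (M : TaskMDP S A C) {π π' : TaskPolicy S A C}
    (h : ∀ s c, 0 < M.visit π' s c → ∀ a, 0 < π'.prob s c a) {s : S} {c : C}
    (hs : 0 < M.visit π s c) : 0 < M.visit π' s c := by
  have hp : 0 < M.p c := (M.p_nonneg c).lt_of_ne fun h0 => by simp [visit, ← h0] at hs
  -- The factor `γ ^ t` stays in the induction because for `γ = 0` only the initial state counts.
  have key : ∀ (t : ℕ) (s : S), 0 < M.γ ^ t * M.stateLaw π c t s → 0 < M.visit π' s c := by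
    intro t
    induction t with
    | zero =>
      intro s hs
      have hs : 0 < M.ρ₀ s := by simpa [stateLaw] using hs
      exact (mul_pos hp hs).trans_le (M.mul_le_visit π' s c)
    | succ t ih =>
      intro s hs
      have hγt : M.γ ^ (t + 1) ≠ 0 := fun h0 => by simp [h0] at hs
      have hγ : 0 < M.γ := M.γ_nonneg.lt_of_ne fun h0 => by simp [← h0] at hγt
      have h1 : 0 < M.stateLaw π c (t + 1) s := pos_of_mul_pos_right hs (pow_pos hγ _).le
      have h1 : (0 : ℝ) < ∑ s', ∑ a, M.stateLaw π c t s' * π.prob s' c a * M.P s' a s := h1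
      obtain ⟨s', -, h2⟩ := Finset.exists_lt_of_sum_lt (f := fun _ => (0 : ℝ)) (by simpa using h1)
      obtain ⟨a, -, h3⟩ := Finset.exists_lt_of_sum_lt (f := fun _ => (0 : ℝ)) (by simpa using h2)
      have hP : 0 < M.P s' a s := (M.P_nonneg _ _ _).lt_of_ne fun h0 => by simp [← h0] at h3
      have hL : 0 < M.stateLaw π c t s' :=
        (M.stateLaw_nonneg π c t s').lt_of_ne fun h0 => by simp [← h0] at h3
      have hv := ih s' (mul_pos (pow_pos hγ t) hL)
      have hpos : 0 < M.visit π' s' c * π'.prob s' c a * M.P s' a s :=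
        mul_pos (mul_pos hv (h s' c hv a)) hP
      rw [M.visit_eq π' s c]
      refine add_pos_of_nonneg_of_pos (mul_nonneg hp.le (M.ρ₀_nonneg s)) (mul_pos hγ ?_)
      have hnn : ∀ s' a, 0 ≤ M.visit π' s' c * π'.prob s' c a * M.P s' a s := fun s' a =>
        mul_nonneg (M.occ_nonneg π' s' a c) (M.P_nonneg _ _ _)
      refine Finset.sum_pos' (fun s' _ => Finset.sum_nonneg fun a _ => hnn s' a)
        ⟨s', Finset.mem_univ _, Finset.sum_pos' (fun a _ => hnn s' a) ⟨a, Finset.mem_univ _, hpos⟩⟩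
  by_contra hcon
  have h0 : ∀ t, M.γ ^ t * M.stateLaw π c t s = 0 := fun t =>
    le_antisymm (not_lt.1 fun h => hcon (key t s h))
      (mul_nonneg (pow_nonneg M.γ_nonneg t) (M.stateLaw_nonneg π c t s))
  simp [visit, h0] at hs

theorem visit_eq_of_occ_eq (M : TaskMDP S A C) {π π' : TaskPolicy S A C}
    (h : M.occ π = M.occ π') (s : S) (c : C) : M.visit π s c = M.visit π' s c := by
  rw [← sum_occ, h, sum_occ]

theorem prob_eq_of_occ_eq (M : TaskMDP S A C) {π π' : TaskPolicy S A C}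
    (h : M.occ π = M.occ π') {s : S} {c : C} (hs : 0 < M.visit π s c) (a : A) :
    π.prob s c a = π'.prob s c a := by
  have h1 : M.occ π s a c = M.occ π' s a c := by rw [h]
  rw [occ, occ, ← M.visit_eq_of_occ_eq h] at h1
  exact mul_left_cancel₀ hs.ne' h1

/-- Policies that agree on the states visited by one of them have the same occupancy. -/
theorem occ_eq_of_prob_eq (M : TaskMDP S A C) {π π' : TaskPolicy S A C}
    (h : ∀ s c, 0 < M.visit π s c → ∀ a, π.prob s c a = π'.prob s c a) :
    M.occ π = M.occ π' := by
  have h1 : ∀ s a c, M.visit π s c * π.prob s c a = M.visit π s c * π'.prob s c a := by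
    intro s a c
    rcases (M.visit_nonneg π s c).eq_or_lt with h0 | h0
    · simp [← h0]
    · rw [h s c h0]
  -- The visitation of `π` also solves the flow equation of `π'`.
  have h2 := M.visit_unique π' (M.visit π) fun s c => by
    simp_rw [← h1]
    exact M.visit_eq π s c
  funext s a c
  rw [occ, h1, h2, occ]

/-- The flow equation is linear in the occupancy; conditioning the mixed occupancy on the state
recovers a policy that realizes it. -/
theorem exists_mixture (M : TaskMDP S A C) (π₁ π₂ : TaskPolicy S A C) {t : ℝ} (h0 : 0 < t)
    (h1 : t < 1) : ∃ π : TaskPolicy S A C,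
      (∀ s c, M.visit π s c = (1 - t) * M.visit π₁ s c + t * M.visit π₂ s c) ∧
      ∀ s a c, M.occ π s a c = (1 - t) * M.occ π₁ s a c + t * M.occ π₂ s a c := by
  classical
  have ht : 0 < 1 - t := by linarith
  set d : S → C → ℝ := fun s c => (1 - t) * M.visit π₁ s c + t * M.visit π₂ s c with hd
  have hdn : ∀ s c, 0 ≤ d s c := fun s c =>
    add_nonneg (mul_nonneg ht.le (M.visit_nonneg _ _ _)) (mul_nonneg h0.le (M.visit_nonneg _ _ _))
  let π : TaskPolicy S A C :=
    -- At unvisited states the quotient would be `0`, not a distribution, so any policy fills in.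
    { prob := fun s c a => if d s c = 0 then π₁.prob s c a else
        ((1 - t) * M.occ π₁ s a c + t * M.occ π₂ s a c) / d s c
      nonneg := fun s c a => by
        split_ifs
        · exact π₁.nonneg s c a
        · exact div_nonneg (add_nonneg (mul_nonneg ht.le (M.occ_nonneg _ _ _ _))
            (mul_nonneg h0.le (M.occ_nonneg _ _ _ _))) (hdn s c)
      sum_one := fun s c => by
        split_ifs with h
        · exact π₁.sum_one s c
        · rw [← Finset.sum_div, Finset.sum_add_distrib, ← Finset.mul_sum, ← Finset.mul_sum,
            sum_occ, sum_occ]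
          exact div_self h }
  have hocc : ∀ s a c, d s c * π.prob s c a =
      (1 - t) * M.occ π₁ s a c + t * M.occ π₂ s a c := by
    intro s a c
    by_cases h : d s c = 0
    · have e1 := mul_nonneg ht.le (M.visit_nonneg π₁ s c)
      have e2 := mul_nonneg h0.le (M.visit_nonneg π₂ s c)
      have h' : (1 - t) * M.visit π₁ s c + t * M.visit π₂ s c = 0 := h
      have v1 : M.visit π₁ s c = 0 := by
        have : (1 - t) * M.visit π₁ s c = 0 := by linarith
        exact (mul_eq_zero.1 this).resolve_left ht.ne'
      have v2 : M.visit π₂ s c = 0 := by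
        have : t * M.visit π₂ s c = 0 := by linarith
        exact (mul_eq_zero.1 this).resolve_left h0.ne'
      simp [h, occ, v1, v2]
    · simp only [π, if_neg h]
      rw [mul_div_cancel₀ _ h]
  have hv := M.visit_unique π d fun s c => by
    simp_rw [hocc]
    simp only [hd]
    rw [M.visit_eq π₁ s c, M.visit_eq π₂ s c]
    simp only [occ, add_mul, Finset.sum_add_distrib, mul_assoc, ← Finset.mul_sum]
    ring
  refine ⟨π, fun s c => (hv s c).symm, fun s a c => ?_⟩
  rw [occ, ← hv, hocc]

/-! ### Expectations -/

theorem expect_congr (M : TaskMDP S A C) (π : TaskPolicy S A C) {g h : S → A → C → ℝ}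
    (hgh : ∀ s a c, 0 < M.visit π s c → 0 < π.prob s c a → g s a c = h s a c) :
    M.expect π g = M.expect π h := by
  refine Finset.sum_congr rfl fun s _ => Finset.sum_congr rfl fun a _ =>
    Finset.sum_congr rfl fun c _ => ?_
  rcases (M.visit_nonneg π s c).eq_or_lt with h0 | h0
  · simp [occ, ← h0]
  rcases (π.nonneg s c a).eq_or_lt with h1 | h1
  · simp [occ, ← h1]
  rw [hgh s a c h0 h1]

theorem rlObjective_eq (M : TaskMDP S A C) (l : S → A → C → ℝ) (π : TaskPolicy S A C) :
    M.rlObjective l π =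
      ∑ s, ∑ a, ∑ c, M.occ π s a c * (Real.log (π.prob s c a) + l s a c) := by
  simp [rlObjective, entropy, expect, pairing, mul_add, Finset.sum_add_distrib]

theorem expect_eq_of_occ_eq (M : TaskMDP S A C) {π π' : TaskPolicy S A C}
    (h : M.occ π = M.occ π') (g : S → A → C → ℝ) : M.expect π g = M.expect π' g := by
  rw [expect, expect, h]

theorem entropy_eq_of_occ_eq (M : TaskMDP S A C) {π π' : TaskPolicy S A C}
    (h : M.occ π = M.occ π') : M.entropy π = M.entropy π' := by
  rw [entropy, entropy, ← M.expect_eq_of_occ_eq h]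
  refine M.expect_congr π fun s a c hs _ => ?_
  rw [M.prob_eq_of_occ_eq h hs]

theorem rlObjective_eq_of_occ_eq (M : TaskMDP S A C) {π π' : TaskPolicy S A C}
    (h : M.occ π = M.occ π') (l : S → A → C → ℝ) : M.rlObjective l π = M.rlObjective l π' := by
  rw [rlObjective, rlObjective, M.entropy_eq_of_occ_eq h, M.expect_eq_of_occ_eq h]

theorem IsRLSolution.of_occ_eq {M : TaskMDP S A C} {l : S → A → C → ℝ} {π π' : TaskPolicy S A C}
    (hπ : M.IsRLSolution l π) (h : M.occ π' = M.occ π) : M.IsRLSolution l π' := fun π'' => by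
  rw [M.rlObjective_eq_of_occ_eq h]
  exact hπ π''

/-- Since `x log x ≥ x - 1 ≥ -1`, each summand is bounded. Without a lower bound the real infimum in
`irlObjective` would be a default value. -/
theorem bddBelow_rlObjective (M : TaskMDP S A C) (l : S → A → C → ℝ) :
    BddBelow (Set.range (M.rlObjective l)) := by
  refine ⟨∑ s : S, ∑ a : A, ∑ c : C, -((1 - M.γ)⁻¹ * (1 + |l s a c|)), ?_⟩
  rintro _ ⟨π, rfl⟩
  rw [rlObjective_eq]
  refine Finset.sum_le_sum fun s _ => Finset.sum_le_sum fun a _ => Finset.sum_le_sum fun c _ => ?_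
  have h1 := sub_le_mul_log_sub_log (π.nonneg s c a) zero_le_one fun _ => zero_lt_one
  rw [Real.log_one, sub_zero] at h1
  have h2 := mul_le_mul_of_nonneg_left h1 (M.visit_nonneg π s c)
  have h3 := M.visit_le π s c
  have h4 := M.occ_le π s a c
  have h5 := mul_le_mul_of_nonneg_left (neg_abs_le (l s a c)) (M.occ_nonneg π s a c)
  have h6 := mul_le_mul_of_nonneg_right h4 (abs_nonneg (l s a c))
  have h7 := mul_nonneg (M.visit_nonneg π s c) (π.nonneg s c a)
  simp only [occ] at *
  nlinarith

/-! ### Divergence and the solutions of entropy-regularized RL -/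

/-- The discounted Kullback-Leibler divergence between `π` and `π'` along `π`. -/
noncomputable def divergence (M : TaskMDP S A C) (π π' : TaskPolicy S A C) : ℝ :=
  M.expect π fun s a c => Real.log (π.prob s c a) - Real.log (π'.prob s c a)

/-- The subtracted `π - π'` sums to zero over actions; it makes the summands individually
nonnegative. -/
theorem divergence_eq (M : TaskMDP S A C) (π π' : TaskPolicy S A C) :
    M.divergence π π' = ∑ s, ∑ a, ∑ c, M.visit π s c *
      (π.prob s c a * (Real.log (π.prob s c a) - Real.log (π'.prob s c a)) -
        (π.prob s c a - π'.prob s c a)) := by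
  have h : ∑ s, ∑ a, ∑ c, M.visit π s c * (π.prob s c a - π'.prob s c a) = 0 := by
    refine Finset.sum_eq_zero fun s _ => ?_
    rw [Finset.sum_comm]
    refine Finset.sum_eq_zero fun c _ => ?_
    rw [← Finset.mul_sum, Finset.sum_sub_distrib, π.sum_one, π'.sum_one]
    simp
  simp_rw [mul_sub (M.visit π _ _) (π.prob _ _ _ * _), Finset.sum_sub_distrib]
  rw [h, sub_zero]
  simp_rw [divergence, expect, pairing, occ, mul_assoc]

/-- Absolute continuity is assumed because `Real.log 0 = 0` would replace an infinite divergence by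
a possibly negative number. -/
theorem divergence_term_nonneg (M : TaskMDP S A C) {π π' : TaskPolicy S A C}
    (h : ∀ s c a, 0 < M.visit π s c → 0 < π.prob s c a → 0 < π'.prob s c a) (s : S) (a : A)
    (c : C) : 0 ≤ M.visit π s c *
      (π.prob s c a * (Real.log (π.prob s c a) - Real.log (π'.prob s c a)) -
        (π.prob s c a - π'.prob s c a)) := by
  rcases (M.visit_nonneg π s c).eq_or_lt with h0 | h0
  · simp [← h0]
  · exact mul_nonneg h0.le (sub_nonneg.2
      (sub_le_mul_log_sub_log (π.nonneg _ _ _) (π'.nonneg _ _ _) (h s c a h0)))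

theorem divergence_nonneg (M : TaskMDP S A C) {π π' : TaskPolicy S A C}
    (h : ∀ s c a, 0 < M.visit π s c → 0 < π.prob s c a → 0 < π'.prob s c a) :
    0 ≤ M.divergence π π' := by
  rw [divergence_eq]
  exact Finset.sum_nonneg fun s _ => Finset.sum_nonneg fun a _ => Finset.sum_nonneg fun c _ =>
    M.divergence_term_nonneg h s a c

theorem eq_zero_of_sum_le_zero {g : S → A → C → ℝ} (h : ∀ s a c, 0 ≤ g s a c)
    (hg : ∑ s, ∑ a, ∑ c, g s a c ≤ 0) (s : S) (a : A) (c : C) : g s a c = 0 := by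
  have h3 : ∀ s a, 0 ≤ ∑ c, g s a c := fun s a => Finset.sum_nonneg fun c _ => h s a c
  have h2 : ∀ s, 0 ≤ ∑ a, ∑ c, g s a c := fun s => Finset.sum_nonneg fun a _ => h3 s a
  have e1 := (Finset.sum_eq_zero_iff_of_nonneg fun s _ => h2 s).1
    (hg.antisymm (Finset.sum_nonneg fun s _ => h2 s)) s (Finset.mem_univ s)
  have e2 := (Finset.sum_eq_zero_iff_of_nonneg fun a _ => h3 s a).1 e1 a (Finset.mem_univ a)
  exact (Finset.sum_eq_zero_iff_of_nonneg fun c _ => h s a c).1 e2 c (Finset.mem_univ c)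

theorem occ_eq_of_divergence_le (M : TaskMDP S A C) {π π' : TaskPolicy S A C}
    (h : ∀ s c a, 0 < M.visit π s c → 0 < π.prob s c a → 0 < π'.prob s c a)
    (hd : M.divergence π π' ≤ 0) : M.occ π = M.occ π' := by
  refine M.occ_eq_of_prob_eq fun s c hs a => ?_
  rw [divergence_eq] at hd
  have h1 := eq_zero_of_sum_le_zero (M.divergence_term_nonneg h) hd s a c
  have h2 := (mul_eq_zero.1 h1).resolve_left hs.ne'
  exact eq_of_mul_log_sub_log_le (π.nonneg _ _ _) (π'.nonneg _ _ _) (h s c a hs)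
    (sub_eq_zero.1 h2).le

/-- Only `log π` depends nonlinearly on the occupancy, so replacing it by `log π₁` and `log π₂`
costs exactly the two divergences. -/
theorem rlObjective_mixture (M : TaskMDP S A C) (l : S → A → C → ℝ) {π₁ π₂ π : TaskPolicy S A C}
    {t : ℝ} (h : ∀ s a c, M.occ π s a c = (1 - t) * M.occ π₁ s a c + t * M.occ π₂ s a c) :
    M.rlObjective l π = (1 - t) * (M.rlObjective l π₁ - M.divergence π₁ π) +
      t * (M.rlObjective l π₂ - M.divergence π₂ π) := by
  simp only [rlObjective_eq, divergence, expect, pairing, h, ← Finset.sum_sub_distrib,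
    Finset.mul_sum, ← Finset.sum_add_distrib]
  exact Finset.sum_congr rfl fun s _ => Finset.sum_congr rfl fun a _ =>
    Finset.sum_congr rfl fun c _ => by ring

theorem prob_pos_of_occ_eq_mixture (M : TaskMDP S A C) {π₁ π₂ π : TaskPolicy S A C}
    {t : ℝ} (h0 : 0 < t) (h1 : t < 1)
    (h : ∀ s a c, M.occ π s a c = (1 - t) * M.occ π₁ s a c + t * M.occ π₂ s a c)
    (s : S) (c : C) (a : A) :
    (0 < M.visit π₁ s c → 0 < π₁.prob s c a → 0 < π.prob s c a) ∧
      (0 < M.visit π₂ s c → 0 < π₂.prob s c a → 0 < π.prob s c a) := by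
  have ht : 0 < 1 - t := by linarith
  have key : 0 < M.occ π s a c → 0 < π.prob s c a := fun hp =>
    pos_of_mul_pos_right hp (M.visit_nonneg π s c)
  constructor
  · intro hv hp
    refine key ?_
    rw [h]
    exact add_pos_of_pos_of_nonneg (mul_pos ht (mul_pos hv hp))
      (mul_nonneg h0.le (M.occ_nonneg _ _ _ _))
  · intro hv hp
    refine key ?_
    rw [h]
    exact add_pos_of_nonneg_of_pos (mul_nonneg ht.le (M.occ_nonneg _ _ _ _))
      (mul_pos h0 (mul_pos hv hp))

/-- All solutions of an entropy-regularized RL problem have the same occupancy. -/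
theorem IsRLSolution.occ_eq {M : TaskMDP S A C} {l : S → A → C → ℝ} {π₁ π₂ : TaskPolicy S A C}
    (h₁ : M.IsRLSolution l π₁) (h₂ : M.IsRLSolution l π₂) : M.occ π₁ = M.occ π₂ := by
  obtain ⟨π, -, hocc⟩ := M.exists_mixture π₁ π₂ (t := 1 / 2) (by norm_num) (by norm_num)
  have hac := M.prob_pos_of_occ_eq_mixture (by norm_num) (by norm_num) hocc
  have k₁ := M.divergence_nonneg fun s c a => (hac s c a).1
  have k₂ := M.divergence_nonneg fun s c a => (hac s c a).2
  have e := M.rlObjective_mixture l hocc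
  have e₁ := h₁ π
  have e₂ := h₂ π
  -- At the midpoint, optimality of both policies leaves no room for a positive divergence.
  exact (M.occ_eq_of_divergence_le (fun s c a => (hac s c a).1) (by linarith)).trans
    (M.occ_eq_of_divergence_le (fun s c a => (hac s c a).2) (by linarith)).symm

/-- A solution of an entropy-regularized RL problem takes every action wherever it goes. -/
theorem IsRLSolution.prob_pos {M : TaskMDP S A C} {l : S → A → C → ℝ} {π : TaskPolicy S A C}
    (h : M.IsRLSolution l π) {s : S} {c : C} (hs : 0 < M.visit π s c) (a : A) :
    0 < π.prob s c a := by
  refine (π.nonneg s c a).lt_of_ne fun h0 => ?_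
  have : Nonempty A := ⟨a⟩
  set u := TaskPolicy.uniform S A C with hu
  have hup : ∀ s c a, 0 < u.prob s c a := fun s c a => by
    simp only [hu, TaskPolicy.uniform]
    positivity
  have hus : 0 < M.visit u s c := M.visit_pos_of_visit_pos (fun s c _ => hup s c) hs
  have hocu : 0 < M.occ u s a c := mul_pos hus (hup s c a)
  set B := M.rlObjective l u - M.rlObjective l π -
    M.expect u (fun s a c => Real.log (u.prob s c a)) with hB
  -- Mixing in a fraction `t` of `u` cannot lower the objective, which bounds `M.divergence u π'`
  -- independently of `t`. But the mixture takes the missing action with probability `O(t)`, so this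
  -- divergence grows like `-log t`. The bound `t ≤ 1 / 2` keeps half of the visitation of `π`.
  have key : ∀ t : ℝ, 0 < t → t ≤ 1 / 2 →
      -Real.log (t * (2 * M.occ u s a c / M.visit π s c)) ≤ B / M.occ u s a c := by
    intro t ht ht2
    obtain ⟨π', hv, hocc⟩ := M.exists_mixture π u ht (by linarith)
    have hac := M.prob_pos_of_occ_eq_mixture ht (by linarith) hocc
    have k := M.divergence_nonneg fun s c a => (hac s c a).1
    have e := M.rlObjective_mixture l hocc
    have e1 := h π'
    have k2 : M.divergence u π' ≤ M.rlObjective l u - M.rlObjective l π := by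
      have := mul_nonneg (show 0 ≤ 1 - t by linarith) k
      have : t * M.divergence u π' ≤ t * (M.rlObjective l u - M.rlObjective l π) := by linarith
      exact le_of_mul_le_mul_left this ht
    have k3 : M.divergence u π' = M.expect u (fun s a c => Real.log (u.prob s c a)) +
        ∑ s, ∑ a, ∑ c, M.occ u s a c * -Real.log (π'.prob s c a) := by
      simp [divergence, expect, pairing, mul_add, Finset.sum_add_distrib, sub_eq_add_neg]
    have hnn : ∀ s a c, 0 ≤ M.occ u s a c * -Real.log (π'.prob s c a) := fun s a c =>
      mul_nonneg (M.occ_nonneg _ _ _ _)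
        (neg_nonneg.2 (Real.log_nonpos (π'.nonneg _ _ _) (π'.prob_le_one _ _ _)))
    have k4 : M.occ u s a c * -Real.log (π'.prob s c a) ≤
        ∑ s, ∑ a, ∑ c, M.occ u s a c * -Real.log (π'.prob s c a) :=
      (Finset.single_le_sum (f := fun c => M.occ u s a c * -Real.log (π'.prob s c a))
        (fun c _ => hnn s a c) (Finset.mem_univ c)).trans <|
      (Finset.single_le_sum (f := fun a => ∑ c, M.occ u s a c * -Real.log (π'.prob s c a))
        (fun a _ => Finset.sum_nonneg fun c _ => hnn s a c) (Finset.mem_univ a)).trans <|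
      Finset.single_le_sum (f := fun s => ∑ a, ∑ c, M.occ u s a c * -Real.log (π'.prob s c a))
        (fun s _ => Finset.sum_nonneg fun a _ => Finset.sum_nonneg fun c _ => hnn s a c)
        (Finset.mem_univ s)
    have hpos := (hac s c a).2 hus (hup s c a)
    have k5 : π'.prob s c a ≤ t * (2 * M.occ u s a c / M.visit π s c) := by
      have e2 : M.visit π' s c * π'.prob s c a = t * M.occ u s a c := by
        have := hocc s a c
        simpa [occ, ← h0] using this
      have e3 : M.visit π s c / 2 ≤ M.visit π' s c := by
        rw [hv]
        have := mul_nonneg ht.le (M.visit_nonneg u s c)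
        nlinarith
      have e4 := mul_le_mul_of_nonneg_right e3 hpos.le
      rw [← mul_div_assoc, le_div_iff₀ hs]
      linarith
    have k6 := Real.log_le_log hpos k5
    rw [le_div_iff₀ hocu]
    have k7 := mul_le_mul_of_nonneg_left (neg_le_neg k6) hocu.le
    linarith
  set K := 2 * M.occ u s a c / M.visit π s c with hK
  have hKp : 0 < K := by positivity
  -- Chosen so that `-log r` exceeds the bound in `key` by one.
  set r := Real.exp (-(B / M.occ u s a c) - 1) with hr
  have hrp : 0 < r := Real.exp_pos _
  have h1 := key (min (1 / 2) (r / K)) (by positivity) (min_le_left _ _)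
  have h2 : min (1 / 2) (r / K) * K ≤ r :=
    (mul_le_mul_of_nonneg_right (min_le_right _ _) hKp.le).trans (by rw [div_mul_cancel₀ _ hKp.ne'])
  have h3 := Real.log_le_log (mul_pos (by positivity) hKp) h2
  rw [hr, Real.log_exp] at h3
  linarith

/-! ### The discriminator -/

/-- The normalizer `log (exp f + π)` cancels between `log (1 - D)` and `log D`, leaving `log π - f`.
-/
theorem genObjective_eq_rlObjective (M : TaskMDP S A C) (f : S → A → C → ℝ)
    (π : TaskPolicy S A C) :
    M.genObjective f π = M.rlObjective (fun s a c => -f s a c) π := by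
  have h := M.expect_congr π (g := fun s a c => Real.log (1 - disc f π s a c))
    (h := fun s a c => Real.log (π.prob s c a) -
      Real.log (Real.exp (f s a c) + π.prob s c a)) fun s a c _ hp => log_one_sub_disc f hp
  rw [genObjective, h, rlObjective_eq]
  simp only [expect, pairing, log_disc, ← Finset.sum_sub_distrib]
  exact Finset.sum_congr rfl fun s _ => Finset.sum_congr rfl fun a _ =>
    Finset.sum_congr rfl fun c _ => by ring

theorem discObjective_eq (M : TaskMDP S A C) (πE π : TaskPolicy S A C) (f : S → A → C → ℝ) :
    M.discObjective πE f π = ∑ s, ∑ a, ∑ c,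
      (M.occ πE s a c * (f s a c - Real.log (Real.exp (f s a c) + π.prob s c a)) +
        M.occ π s a c *
          (Real.log (π.prob s c a) - Real.log (Real.exp (f s a c) + π.prob s c a))) := by
  have h := M.expect_congr π (g := fun s a c => Real.log (1 - disc f π s a c))
    (h := fun s a c => Real.log (π.prob s c a) -
      Real.log (Real.exp (f s a c) + π.prob s c a)) fun s a c _ hp => log_one_sub_disc f hp
  rw [discObjective, h]
  simp only [expect, pairing, log_disc, ← Finset.sum_add_distrib]

/-- The first-order condition for the optimal discriminator. -/
theorem occ_eq_visit_mul_exp (M : TaskMDP S A C) {πE π : TaskPolicy S A C} {f : S → A → C → ℝ}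
    (hf : ∀ f', M.discObjective πE f' π ≤ M.discObjective πE f π) {s : S} {a : A} {c : C}
    (hπ : 0 < π.prob s c a) : M.occ πE s a c = M.visit π s c * Real.exp (f s a c) := by
  set T : S × A × C → ℝ → ℝ := fun i x =>
    M.occ πE i.1 i.2.1 i.2.2 * (x - Real.log (Real.exp x + π.prob i.1 i.2.2 i.2.1)) +
      M.occ π i.1 i.2.1 i.2.2 * (Real.log (π.prob i.1 i.2.2 i.2.1) -
        Real.log (Real.exp x + π.prob i.1 i.2.2 i.2.1)) with hT
  have hmax : ∀ x, T (s, a, c) x ≤ T (s, a, c) (f s a c) := by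
    refine le_of_forall_sum_le T (fun i => f i.1 i.2.1 i.2.2) (fun f' => ?_) (s, a, c)
    have := hf fun s a c => f' (s, a, c)
    simpa only [hT, discObjective_eq, Fintype.sum_prod_type] using this
  have hlog : HasDerivAt (fun x : ℝ => Real.log (Real.exp x + π.prob s c a))
      (Real.exp (f s a c) / (Real.exp (f s a c) + π.prob s c a)) (f s a c) :=
    ((Real.hasDerivAt_exp _).add_const _).log (by positivity)
  have hder : HasDerivAt (T (s, a, c))
      (M.occ πE s a c * (1 - Real.exp (f s a c) / (Real.exp (f s a c) + π.prob s c a)) +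
        M.occ π s a c * (0 - Real.exp (f s a c) / (Real.exp (f s a c) + π.prob s c a)))
      (f s a c) :=
    (((hasDerivAt_id _).sub hlog).const_mul _).add
      (((hasDerivAt_const _ _).sub hlog).const_mul _)
  have h0 := (IsLocalMax.hasDerivAt_eq_zero (Filter.Eventually.of_forall hmax) hder)
  have hne : Real.exp (f s a c) + π.prob s c a ≠ 0 := by positivity
  -- The derivative is `(ρ_E π - ρ_π exp f) / (exp f + π)`, and `ρ_π = d_π π`.
  have h1 : π.prob s c a * (M.occ πE s a c - M.visit π s c * Real.exp (f s a c)) = 0 := by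
    rw [occ.eq_1 M π] at h0
    field_simp at h0
    linarith
  exact sub_eq_zero.1 ((mul_eq_zero.1 h1).resolve_left hπ.ne')

/-! ### Adversarial solutions -/

theorem IsAdversarialSolution.isRLSolution {M : TaskMDP S A C} {πE π : TaskPolicy S A C}
    {f : S → A → C → ℝ} (h : M.IsAdversarialSolution πE f π) :
    M.IsRLSolution (fun s a c => -f s a c) π := fun π' => by
  simpa only [genObjective_eq_rlObjective] using h.2 π'

theorem IsAdversarialSolution.occ_eq {M : TaskMDP S A C} {πE π : TaskPolicy S A C}
    {lE f : S → A → C → ℝ} (hE : M.IsRLSolution lE πE) (h : M.IsAdversarialSolution πE f π) :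
    M.occ π = M.occ πE := by
  have hRL := h.isRLSolution
  have hπE : ∀ s c, 0 < M.visit π s c → 0 < M.visit πE s c := fun s c hs =>
    M.visit_pos_of_visit_pos (fun s c hs a => hE.prob_pos hs a) hs
  have hEπ : ∀ s c, 0 < M.visit πE s c → 0 < M.visit π s c := fun s c hs =>
    M.visit_pos_of_visit_pos (fun s c hs a => hRL.prob_pos hs a) hs
  have hf : ∀ s a c, 0 < M.visit π s c →
      f s a c = Real.log (M.occ πE s a c) - Real.log (M.visit π s c) := fun s a c hs => by
    rw [M.occ_eq_visit_mul_exp h.1 (hRL.prob_pos hs a),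
      Real.log_mul hs.ne' (Real.exp_pos _).ne', Real.log_exp]
    ring
  -- With this `f`, the summand for `π` is `ρ_π (log ρ_π - log ρ_E)`; the tangent inequality
  -- applies, with its equality case.
  have lower : ∀ s a c, M.occ π s a c - M.occ πE s a c ≤
      M.occ π s a c * (Real.log (π.prob s c a) + -f s a c) ∧
      (M.occ π s a c * (Real.log (π.prob s c a) + -f s a c) =
        M.occ π s a c - M.occ πE s a c → M.occ π s a c = M.occ πE s a c) := by
    intro s a c
    rcases (M.visit_nonneg π s c).eq_or_lt with h0 | h0
    · have h1 : M.visit πE s c = 0 :=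
        le_antisymm (not_lt.1 fun h => (hEπ s c h).ne h0) (M.visit_nonneg _ _ _)
      simp [occ, ← h0, h1]
    · have hp := hRL.prob_pos h0 a
      have hocc : 0 < M.occ πE s a c := mul_pos (hπE s c h0) (hE.prob_pos (hπE s c h0) a)
      have e : Real.log (π.prob s c a) + -f s a c =
          Real.log (M.occ π s a c) - Real.log (M.occ πE s a c) := by
        rw [hf s a c h0, occ.eq_1 M π, Real.log_mul h0.ne' hp.ne']
        ring
      rw [e]
      exact ⟨sub_le_mul_log_sub_log (M.occ_nonneg _ _ _ _) hocc.le fun _ => hocc, fun h =>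
        eq_of_mul_log_sub_log_le (M.occ_nonneg _ _ _ _) hocc.le (fun _ => hocc) h.le⟩
  -- For the expert, `log π_E - f` is `-(log d_E - log d_π)`. The right side sums to zero, as all
  -- visitations have the same total mass.
  have upper : ∀ s a c, M.occ πE s a c * (Real.log (πE.prob s c a) + -f s a c) ≤
      (M.visit π s c - M.visit πE s c) * πE.prob s c a := by
    intro s a c
    rcases (M.visit_nonneg πE s c).eq_or_lt with h0 | h0
    · have := mul_nonneg (M.visit_nonneg π s c) (πE.nonneg s c a)
      simpa [occ, ← h0] using this
    · have h1 := hEπ s c h0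
      have hp := hE.prob_pos h0 a
      have e : Real.log (πE.prob s c a) + -f s a c =
          -(Real.log (M.visit πE s c) - Real.log (M.visit π s c)) := by
        rw [hf s a c h1, occ.eq_1 M πE, Real.log_mul h0.ne' hp.ne']
        ring
      have := sub_le_mul_log_sub_log h0.le h1.le fun _ => h1
      rw [e, occ]
      nlinarith
  have hle : ∑ s, ∑ a, ∑ c, M.occ π s a c * (Real.log (π.prob s c a) + -f s a c) ≤ 0 := by
    have h1 := hRL πE
    rw [rlObjective_eq, rlObjective_eq] at h1
    refine h1.trans ((Finset.sum_le_sum fun s _ => Finset.sum_le_sum fun a _ =>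
      Finset.sum_le_sum fun c _ => upper s a c).trans ?_)
    have : ∀ s, ∑ a, ∑ c, (M.visit π s c - M.visit πE s c) * πE.prob s c a =
        ∑ c, M.visit π s c - ∑ c, M.visit πE s c := fun s => by
      rw [Finset.sum_comm]
      simp_rw [← Finset.mul_sum, πE.sum_one, mul_one, Finset.sum_sub_distrib]
    simp_rw [this, Finset.sum_sub_distrib, sum_sum_visit, sub_self]
    exact le_rfl
  have hsum : ∑ s, ∑ a, ∑ c, (M.occ π s a c * (Real.log (π.prob s c a) + -f s a c) -
      (M.occ π s a c - M.occ πE s a c)) ≤ 0 := by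
    simp_rw [Finset.sum_sub_distrib, sum_sum_sum_occ, sub_self, sub_zero]
    exact hle
  funext s a c
  exact (lower s a c).2 (sub_eq_zero.1 (eq_zero_of_sum_le_zero
    (fun s a c => sub_nonneg.2 (lower s a c).1) hsum s a c))

theorem IsAdversarialSolution.prob_eq {M : TaskMDP S A C} {πE π : TaskPolicy S A C}
    {lE f : S → A → C → ℝ} (hE : M.IsRLSolution lE πE) (h : M.IsAdversarialSolution πE f π)
    {s : S} {c : C} (hs : 0 < M.visit πE s c) (a : A) :
    π.prob s c a = πE.prob s c a ∧ f s a c = Real.log (πE.prob s c a) := by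
  have hocc := h.occ_eq hE
  have hp := M.prob_eq_of_occ_eq hocc.symm hs a
  refine ⟨hp.symm, ?_⟩
  have h1 := M.occ_eq_visit_mul_exp h.1 (hp ▸ hE.prob_pos hs a : 0 < π.prob s c a)
  rw [M.visit_eq_of_occ_eq hocc, occ] at h1
  rw [mul_left_cancel₀ hs.ne' h1, Real.log_exp]

/-- At the occupancy of the expert, no discriminator beats a coin flip. -/
theorem discObjective_le (M : TaskMDP S A C) {πE π : TaskPolicy S A C} (h : M.occ π = M.occ πE)
    (f : S → A → C → ℝ) : M.discObjective πE f π ≤ -(2 * Real.log 2) * (1 - M.γ)⁻¹ := by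
  rw [discObjective, expect, expect, h, ← M.sum_sum_sum_occ πE]
  simp only [pairing, ← Finset.sum_add_distrib, Finset.mul_sum]
  refine Finset.sum_le_sum fun s _ => Finset.sum_le_sum fun a _ => Finset.sum_le_sum fun c _ => ?_
  rw [← mul_add, mul_comm]
  rcases (M.occ_nonneg πE s a c).eq_or_lt with h0 | h0
  · simp [← h0]
  · have hp : 0 < π.prob s c a := by
      rw [← h] at h0
      exact pos_of_mul_pos_right h0 (M.visit_nonneg π s c)
    refine mul_le_mul_of_nonneg_right (log_le_neg_two_log_two ?_ ?_) h0.le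
    · exact div_pos (Real.exp_pos _) (by positivity)
    · rw [disc, div_lt_one (by positivity)]
      linarith

/-- The value of the discriminator `f = log π`. -/
theorem discObjective_log (M : TaskMDP S A C) (πE π : TaskPolicy S A C) :
    M.discObjective πE (fun s a c => Real.log (π.prob s c a)) π =
      -(2 * Real.log 2) * (1 - M.γ)⁻¹ +
        ∑ s, ∑ a, ∑ c, Real.log 2 * (if π.prob s c a = 0 then M.occ πE s a c else 0) := by
  have h2 : -(2 * Real.log 2) * (1 - M.γ)⁻¹ =
      ∑ s, ∑ a, ∑ c, -(Real.log 2 * M.occ πE s a c + Real.log 2 * M.occ π s a c) := by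
    simp_rw [Finset.sum_neg_distrib, Finset.sum_add_distrib, ← Finset.mul_sum, sum_sum_sum_occ]
    ring
  rw [h2, discObjective]
  simp only [expect, pairing, ← Finset.sum_add_distrib]
  refine Finset.sum_congr rfl fun s _ => Finset.sum_congr rfl fun a _ =>
    Finset.sum_congr rfl fun c _ => ?_
  -- At probability zero, `log 0 = 0` gives `f = 0` and `D = 1`: the expert's term is `0` instead of
  -- `-log 2`, which is the surplus in the formula.
  by_cases hp : π.prob s c a = 0
  · simp [disc, occ, hp]
  · have hpos := (π.nonneg s c a).lt_of_ne' hp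
    have e : disc (fun s a c => Real.log (π.prob s c a)) π s a c = 2⁻¹ := by
      rw [disc, Real.exp_log hpos]
      field_simp
      norm_num
    rw [e, if_neg hp, show (1 - 2⁻¹ : ℝ) = 2⁻¹ by norm_num, Real.log_inv]
    ring

theorem discObjective_log_term_nonneg (M : TaskMDP S A C) (πE π : TaskPolicy S A C) (s : S) (a : A)
    (c : C) : 0 ≤ Real.log 2 * (if π.prob s c a = 0 then M.occ πE s a c else 0) := by
  refine mul_nonneg (Real.log_nonneg one_le_two) ?_
  split_ifs
  exacts [M.occ_nonneg _ _ _ _, le_rfl]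

theorem le_discObjective_log (M : TaskMDP S A C) (πE π : TaskPolicy S A C) :
    -(2 * Real.log 2) * (1 - M.γ)⁻¹ ≤
      M.discObjective πE (fun s a c => Real.log (π.prob s c a)) π := by
  rw [discObjective_log]
  exact le_add_of_nonneg_right <| Finset.sum_nonneg fun s _ => Finset.sum_nonneg fun a _ =>
    Finset.sum_nonneg fun c _ => M.discObjective_log_term_nonneg πE π s a c

/-- If no discriminator beats a coin flip, the occupancy is that of the expert. -/
theorem occ_eq_of_discObjective_le (M : TaskMDP S A C) {πE π : TaskPolicy S A C}
    (h : ∀ f, M.discObjective πE f π ≤ -(2 * Real.log 2) * (1 - M.γ)⁻¹) :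
    M.occ π = M.occ πE := by
  -- So `log π` is an optimal discriminator, and its first-order condition is available.
  have hmax := fun f => (h f).trans (M.le_discObjective_log πE π)
  funext s a c
  rcases (π.nonneg s c a).eq_or_lt with hp | hp
  · have h1 := h fun s a c => Real.log (π.prob s c a)
    rw [discObjective_log] at h1
    have h2 := eq_zero_of_sum_le_zero (M.discObjective_log_term_nonneg πE π)
      (by linarith) s a c
    have h3 := (mul_eq_zero.1 h2).resolve_left (Real.log_pos one_lt_two).ne'
    rw [if_pos hp.symm] at h3
    rw [h3, occ, ← hp, mul_zero]
  · rw [M.occ_eq_visit_mul_exp hmax hp, Real.exp_log hp, occ]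

/-- With cost `-log π` the RL objective of `π'` is its divergence from `π`, which vanishes at `π`.
Nonnegativity uses that `π` inherits full support from the expert's optimality for `lE`. -/
theorem isAdversarialSolution_log (M : TaskMDP S A C) {πE π : TaskPolicy S A C}
    {lE : S → A → C → ℝ} (hE : M.IsRLSolution lE πE) (h : M.occ π = M.occ πE) :
    M.IsAdversarialSolution πE (fun s a c => Real.log (π.prob s c a)) π := by
  refine ⟨fun f => (M.discObjective_le h f).trans (M.le_discObjective_log πE π), fun π' => ?_⟩
  have hπ := fun s c => (hE.of_occ_eq h).prob_pos (s := s) (c := c)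
  rw [genObjective_eq_rlObjective, genObjective_eq_rlObjective, rlObjective_eq, rlObjective_eq]
  have h1 := M.divergence_nonneg (π := π') (π' := π) fun s c a hs _ =>
    hπ s c (M.visit_pos_of_visit_pos hπ hs) a
  simp only [add_neg_cancel, mul_zero, Finset.sum_const_zero]
  simpa only [divergence, expect, pairing, sub_eq_add_neg] using h1

theorem exists_isAdversarialSolution_iff (M : TaskMDP S A C) {πE : TaskPolicy S A C}
    {lE : S → A → C → ℝ} (hE : M.IsRLSolution lE πE) (π : TaskPolicy S A C) :
    (∃ f, M.IsAdversarialSolution πE f π) ↔ M.occ π = M.occ πE :=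
  ⟨fun ⟨_, hf⟩ => hf.occ_eq hE, fun h => ⟨_, M.isAdversarialSolution_log hE h⟩⟩

theorem existsUnique_isAdversarialSolution (M : TaskMDP S A C) {πE : TaskPolicy S A C}
    {lE : S → A → C → ℝ} (hE : M.IsRLSolution lE πE) (hρ : ∀ s, 0 < M.ρ₀ s)
    (hp : ∀ c, 0 < M.p c) :
    ∃! x : (S → A → C → ℝ) × TaskPolicy S A C, M.IsAdversarialSolution πE x.1 x.2 := by
  have hv : ∀ s c, 0 < M.visit πE s c := fun s c =>
    (mul_pos (hp c) (hρ s)).trans_le (M.mul_le_visit πE s c)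
  refine ⟨(fun s a c => Real.log (πE.prob s c a), πE), M.isAdversarialSolution_log hE rfl, ?_⟩
  rintro ⟨f, π⟩ h
  refine Prod.ext ?_ (TaskPolicy.ext ?_)
  · funext s a c
    exact (IsAdversarialSolution.prob_eq hE h (hv s c) a).2
  · funext s c a
    exact (IsAdversarialSolution.prob_eq hE h (hv s c) a).1

/-! ### Inverse reinforcement learning and regularizers -/

/-- Testing the infimum at `πE` bounds the inverse RL objective by `-H(π_E)` for every cost. At `-f`
the bound is attained, since the minimizer `π` has the expert's occupancy. -/
theorem IsAdversarialSolution.isIRLSolution {M : TaskMDP S A C} {πE π : TaskPolicy S A C}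
    {lE f : S → A → C → ℝ} (hE : M.IsRLSolution lE πE) (h : M.IsAdversarialSolution πE f π) :
    M.IsIRLSolution πE (fun s a c => -f s a c) := by
  intro l
  have : Nonempty (TaskPolicy S A C) := ⟨πE⟩
  have h1 : ⨅ π', M.rlObjective l π' ≤ M.rlObjective l πE :=
    ciInf_le (M.bddBelow_rlObjective l) πE
  have h2 := le_ciInf h.isRLSolution
  rw [M.rlObjective_eq_of_occ_eq (h.occ_eq hE)] at h2
  rw [irlObjective, irlObjective]
  rw [rlObjective] at h1 h2
  linarith

theorem pairing_occ_sub (M : TaskMDP S A C) (π πE : TaskPolicy S A C) (l : S → A → C → ℝ) :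
    pairing (M.occ π - M.occ πE) l = M.expect π l - M.expect πE l := by
  simp [pairing, expect, sub_mul, Finset.sum_sub_distrib]

/-- Taking `l = lE` in the conjugate gives the lower bound; at the expert's occupancy the conjugate
is at `0`, where it is minus the minimum of `ψ`. Minimizers thus solve RL for `lE`, whose occupancy
is unique. -/
theorem isRegSolution_iff (M : TaskMDP S A C) {πE : TaskPolicy S A C} {lE : S → A → C → ℝ}
    (hE : M.IsRLSolution lE πE) {ψ : (S → A → C → ℝ) → EReal} (htop : ψ lE ≠ ⊤)
    (hbot : ψ lE ≠ ⊥) (hmin : ∀ l, ψ lE ≤ ψ l) (π : TaskPolicy S A C) :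
    M.IsRegSolution ψ πE π ↔ M.occ π = M.occ πE := by
  lift ψ lE to ℝ using ⟨htop, hbot⟩ with m hm
  have lower : ∀ π, ((M.rlObjective lE π - M.expect πE lE - m : ℝ) : EReal) ≤
      M.regObjective ψ πE π := by
    intro π
    have h1 : ((M.expect π lE - M.expect πE lE : ℝ) : EReal) - m ≤
        conjugate ψ (M.occ π - M.occ πE) := by
      rw [← pairing_occ_sub, hm]
      exact le_iSup (fun l => ((pairing (M.occ π - M.occ πE) l : ℝ) : EReal) - ψ l) lE
    refine le_trans (le_of_eq ?_) (add_le_add_right h1 _)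
    rw [rlObjective, ← EReal.coe_sub, ← EReal.coe_add]
    congr 1
    ring
  have upper : ∀ π, M.occ π = M.occ πE →
      M.regObjective ψ πE π ≤ ((M.rlObjective lE πE - M.expect πE lE - m : ℝ) : EReal) := by
    intro π h
    have h1 : conjugate ψ (M.occ π - M.occ πE) ≤ ((-m : ℝ) : EReal) := by
      refine iSup_le fun l => ?_
      rw [pairing_occ_sub, M.expect_eq_of_occ_eq h, sub_self]
      refine (EReal.sub_le_sub le_rfl (hmin l)).trans (le_of_eq ?_)
      rw [← EReal.coe_sub, zero_sub]
    refine (add_le_add_right h1 _).trans (le_of_eq ?_)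
    rw [rlObjective, ← EReal.coe_add, M.entropy_eq_of_occ_eq h]
    congr 1
    ring
  constructor
  · intro h
    have h1 := EReal.coe_le_coe_iff.1 ((lower π).trans ((h πE).trans (upper πE rfl)))
    exact IsRLSolution.occ_eq (l := lE) (fun π' => by linarith [hE π']) hE
  · intro h π'
    refine (upper π h).trans (le_trans (EReal.coe_le_coe_iff.2 ?_) (lower π'))
    linarith [hE π']

theorem convexOn_discRegularizer (M : TaskMDP S A C) (πE π : TaskPolicy S A C) :
    ConvexOn ℝ Set.univ (M.discRegularizer πE π) := by
  refine ⟨convex_univ, fun x _ y _ a b ha hb hab => ?_⟩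
  have h : ∀ s i c, Real.log (Real.exp (-(a * x s i c + b * y s i c)) + π.prob s c i) ≤
      a * Real.log (Real.exp (-x s i c) + π.prob s c i) +
        b * Real.log (Real.exp (-y s i c) + π.prob s c i) := by
    intro s i c
    have := (convexOn_log_exp_add (π.nonneg s c i)).2 (Set.mem_univ (-x s i c))
      (Set.mem_univ (-y s i c)) ha hb hab
    simp only [smul_eq_mul] at this
    rwa [show a * -x s i c + b * -y s i c = -(a * x s i c + b * y s i c) by ring] at this
  simp only [discRegularizer, expect, pairing, Pi.add_apply, Pi.smul_apply, smul_eq_mul,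
    ← Finset.sum_add_distrib, Finset.mul_sum]
  refine Finset.sum_le_sum fun s _ => Finset.sum_le_sum fun i _ => Finset.sum_le_sum fun c _ => ?_
  have h1 := mul_le_mul_of_nonneg_left (h s i c) (M.occ_nonneg π s i c)
  have h2 := mul_le_mul_of_nonneg_left (h s i c) (M.occ_nonneg πE s i c)
  linarith

theorem regObjective_discRegularizer (M : TaskMDP S A C) (πE π : TaskPolicy S A C) :
    M.regObjective (fun l => (M.discRegularizer πE π l : EReal)) πE π =
      ⨆ f : S → A → C → ℝ, (M.discObjective πE f π : EReal) := by
  have key : ∀ l : S → A → C → ℝ, -M.entropy π +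
      (pairing (M.occ π - M.occ πE) l - M.discRegularizer πE π l) =
        M.discObjective πE (-l) π := by
    intro l
    rw [pairing_occ_sub, discObjective_eq]
    simp only [discRegularizer, entropy, expect, pairing, ← Finset.sum_add_distrib,
      ← Finset.sum_sub_distrib, ← Finset.sum_neg_distrib, Pi.neg_apply]
    exact Finset.sum_congr rfl fun s _ => Finset.sum_congr rfl fun a _ =>
      Finset.sum_congr rfl fun c _ => by ring
  rw [← (Equiv.neg (S → A → C → ℝ)).iSup_comp, regObjective, conjugate]
  simp only [Equiv.neg_apply, ← key, EReal.coe_add, EReal.coe_sub]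
  refine le_antisymm ?_ (iSup_le fun l => add_le_add_right
    (le_iSup (fun l => ((pairing (M.occ π - M.occ πE) l : ℝ) : EReal) -
      (M.discRegularizer πE π l : EReal)) l) _)
  -- In `EReal`, a finite constant can be moved across the supremum.
  rw [add_comm]
  refine EReal.add_le_of_le_sub (iSup_le fun l => ?_)
  rw [EReal.le_sub_iff_add_le (Or.inl (EReal.coe_ne_bot _)) (Or.inl (EReal.coe_ne_top _)),
    add_comm]
  exact le_iSup (fun l => ((-M.entropy π : ℝ) : EReal) +
    (((pairing (M.occ π - M.occ πE) l : ℝ) : EReal) - (M.discRegularizer πE π l : EReal))) l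

/-- The discriminator `log π'` guarantees the coin-flip value against any `π'`, and the expert shows
that this value is attained. -/
theorem forall_iSup_discObjective_le_iff (M : TaskMDP S A C) (πE π : TaskPolicy S A C) :
    (∀ π', ⨆ f : S → A → C → ℝ, (M.discObjective πE f π : EReal) ≤
      ⨆ f : S → A → C → ℝ, (M.discObjective πE f π' : EReal)) ↔ M.occ π = M.occ πE := by
  have upper : ∀ π, M.occ π = M.occ πE → ⨆ f : S → A → C → ℝ, (M.discObjective πE f π : EReal) ≤
      ((-(2 * Real.log 2) * (1 - M.γ)⁻¹ : ℝ) : EReal) := fun π h =>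
    iSup_le fun f => EReal.coe_le_coe_iff.2 (M.discObjective_le h f)
  constructor
  · intro h
    exact M.occ_eq_of_discObjective_le fun f => EReal.coe_le_coe_iff.1
      ((le_iSup (fun f => (M.discObjective πE f π : EReal)) f).trans
        ((h πE).trans (upper πE rfl)))
  · intro h π'
    exact (upper π h).trans ((EReal.coe_le_coe_iff.2 (M.le_discObjective_log πE π')).trans
      (le_iSup (fun f => (M.discObjective πE f π' : EReal)) _))

end TaskMDP

theorem proposition2 {S A C : Type*} [Fintype S] [Fintype A] [Fintype C]
    (M : TaskMDP S A C) (πE : TaskPolicy S A C) (lE : S → A → C → ℝ)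
    (hE : M.IsRLSolution lE πE) :
    -- the policies of the adversarial problem are the solutions of the regularized problem
    -- without penalty on the costs, as in the inverse RL problem ...
    (∀ π, (∃ f, M.IsAdversarialSolution πE f π) ↔ M.IsRegSolution (fun _ => 0) πE π) ∧
    -- ... and with every regularizer whose minimum is attained at the expert's cost
    (∀ ψ : (S → A → C → ℝ) → EReal, ψ lE ≠ ⊤ → ψ lE ≠ ⊥ → (∀ l, ψ lE ≤ ψ l) →
      ∀ π, (∃ f, M.IsAdversarialSolution πE f π) ↔ M.IsRegSolution ψ πE π) ∧
    -- the same holds with the convex regularizer induced by the discriminator, for which the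
    -- regularized objective is the maximal value of the discriminator objective
    (∀ π, ConvexOn ℝ Set.univ (M.discRegularizer πE π) ∧
      M.regObjective (fun l => (M.discRegularizer πE π l : EReal)) πE π =
        ⨆ f : S → A → C → ℝ, (M.discObjective πE f π : EReal)) ∧
    (∀ π, (∃ f, M.IsAdversarialSolution πE f π) ↔
      ∀ π', M.regObjective (fun l => (M.discRegularizer πE π l : EReal)) πE π ≤
        M.regObjective (fun l => (M.discRegularizer πE π' l : EReal)) πE π') ∧
    -- the generator problem is RL and the discriminator returns a solution of inverse RL
    (∀ f π, M.genObjective f π = M.rlObjective (fun s a c => -f s a c) π) ∧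
    (∀ f π, M.IsAdversarialSolution πE f π →
      M.IsIRLSolution πE (fun s a c => -f s a c) ∧
        M.IsRLSolution (fun s a c => -f s a c) π) ∧
    -- uniqueness of the solution
    (∀ π, (∃ f, M.IsAdversarialSolution πE f π) ↔ M.occ π = M.occ πE) ∧
    (∀ f π, M.IsAdversarialSolution πE f π → ∀ s c, 0 < M.visit πE s c → ∀ a,
      π.prob s c a = πE.prob s c a ∧ f s a c = Real.log (πE.prob s c a)) ∧
    ((∀ s, 0 < M.ρ₀ s) → (∀ c, 0 < M.p c) →
      ∃! x : (S → A → C → ℝ) × TaskPolicy S A C, M.IsAdversarialSolution πE x.1 x.2) := by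
  have key := M.exists_isAdversarialSolution_iff hE
  refine ⟨fun π => ?_, fun ψ htop hbot hmin π => ?_,
    fun π => ⟨M.convexOn_discRegularizer πE π, M.regObjective_discRegularizer πE π⟩, fun π => ?_,
    M.genObjective_eq_rlObjective, fun f π h => ⟨h.isIRLSolution hE, h.isRLSolution⟩, key,
    fun f π h s c hs a => h.prob_eq hE hs a, M.existsUnique_isAdversarialSolution hE⟩
  · rw [key, M.isRegSolution_iff hE (by simp) (by simp) (by simp)]
  · rw [key, M.isRegSolution_iff hE htop hbot hmin]
  · simp_rw [key, TaskMDP.regObjective_discRegularizer]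
    exact (M.forall_iSup_discObjective_le_iff πE π).symm
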